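/- **Theorem (running time of localized work stealing under even distribution).** *Model.* There are $P\ge 1$ processors. Processor $i$ owns a (possibly empty) balanced binary tree whose leaves are serial tasks of positive integer sizes. Let $T_1$ be the total size of all tasks, and let $T_\infty$ be the height of the tree obtained by connecting the $P$ roots through a binary tree of height $\lceil\lg P\rceil$, plus the size of the largest task. Initially each processor works on its own tree. In every timestep each busy processor executes one unit of work, going through the tasks of its current subtree in the given order, and each free processor $p$ makes one steal attempt: if other processors are working on work owned by $p$, it chooses its victim uniformly among these (*steal-back*), and otherwise uniformly among all processors that have work left (*general steal*), the choices being independent given the past. If several processors attack the same victim, an arbitrary one of them comes through and the others fail; the one that comes through takes the main branch of the victim's current subtree on which the victim is not working (nothing, if only a single task remains). The running time $T$ is the first time at which no work is left. A processor is an *owner left* as long as its own work is not completed, and a *free agent* afterwards. The *even distribution of free agents assumption* is that at all times, when $k$ owners are left, for each of them at most $\lceil (P-k)/k\rceil$ other processors are working on its work. *Claim.* There is an absolute constant $C>0$ such that the following holds for all such computations and all executions. If the even distribution of free agents assumption holds almost surely, then $$\mathbb E[T]\le \frac{T_1}{P}+C\,T_\infty\lg P ,$$ and for every $\varepsilon>0$,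 with probability at least $1-\varepsilon$, $$T\le \frac{T_1}{P}+C\lg P\,\bigl(T_\infty+\lg(P/\varepsilon)\bigr).$$ More generally, if $E$ denotes the event that the assumption holds throughout the execution, then without any hypothesis on $E$ $$\mathbb E[T\,\mathbf 1_E]\le \frac{T_1}{P}\Pr[E]+C\,T_\infty\lg P ,\qquad \Pr\Bigl[E\ \text{and}\ T>\frac{T_1}{P}+C\lg P\,\bigl(T_\infty+\lg(P/\varepsilon)\bigr)\Bigr]\le\varepsilon\quad(\varepsilon>0).$$ -/

import Mathlib

open MeasureTheory
open scoped ENNReal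

/-- A nonempty binary tree of serial tasks. `leaf r` is a single serial task of which `r + 1` units
of work (a positive integer) remain to be executed. -/
inductive TaskTree : Type
  | leaf (r : ℕ) : TaskTree
  | node (l r : TaskTree) : TaskTree

namespace TaskTree

/-- The number of serial tasks of the tree. -/
def numTasks : TaskTree → ℕ
  | leaf _ => 1
  | node l r => l.numTasks + r.numTasks

/-- The total (remaining) size of the serial tasks of the tree. -/
def work : TaskTree → ℕ
  | leaf r => r + 1
  | node l r => l.work + r.work

/-- The height of the tree, a single serial task having height `0`. -/
def height : TaskTree → ℕ
  | leaf _ => 0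
  | node l r => max l.height r.height + 1

/-- The size of the largest serial task of the tree. -/
def maxSize : TaskTree → ℕ
  | leaf r => r + 1
  | node l r => max l.maxSize r.maxSize

/-- At every branching the numbers of serial tasks on the two branches differ by at most one. -/
def Balanced : TaskTree → Prop
  | leaf _ => True
  | node l r =>
      l.numTasks ≤ r.numTasks + 1 ∧ r.numTasks ≤ l.numTasks + 1 ∧ l.Balanced ∧ r.Balanced

/-- One timestep of work. The tasks are executed from left to right, so one unit of the leftmost
task is executed; a finished task disappears, and `none` means that nothing remains. -/
def exec : TaskTree → Option TaskTree
  | leaf 0 => none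
  | leaf (r + 1) => some (leaf r)
  | node l r =>
      match l.exec with
      | none => some r
      | some l' => some (node l' r)

/-- What a successful thief takes: the main branch on which the processor is not working.
Nothing can be taken from a processor that is down to a single serial task. -/
def stolen : TaskTree → Option TaskTree
  | leaf _ => none
  | node _ r => some r

/-- What the victim of a steal is left with: the main branch on which it is working. -/
def kept : TaskTree → TaskTree
  | leaf r => leaf r
  | node l _ => l

end TaskTree

/-- A computation for `P` processors: processor `i` owns the serial tasks of the balanced tree
`tree i`, where `none` means that it owns no serial task. -/
structure TaskComputation (P : ℕ) where
  tree : Fin P → Option TaskTree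
  balanced : ∀ i τ, tree i = some τ → τ.Balanced

namespace TaskComputation

variable {P : ℕ}

/-- The work `T₁`: the total size of all serial tasks. -/
def T1 (c : TaskComputation P) : ℕ :=
  ∑ i, (c.tree i).elim 0 TaskTree.work

/-- The span `T_∞`: the height of the tree that is obtained by connecting the `P` roots through a
binary tree of height `⌈lg P⌉`, plus the size of the largest serial task. -/
def Tinf (c : TaskComputation P) : ℕ :=
  Nat.clog 2 P
    + (Finset.univ.sup fun i => (c.tree i).elim 0 TaskTree.height)
    + (Finset.univ.sup fun i => (c.tree i).elim 0 TaskTree.maxSize)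

end TaskComputation

/-- A configuration says for each processor whether it is free (`none`), or works for an owner `o`
on a remaining piece `τ` of the tree of `o` (`some (o, τ)`). -/
abbrev Config (P : ℕ) : Type := Fin P → Option (Fin P × TaskTree)

namespace Config

variable {P : ℕ}

/-- At the start every processor works on its own tree. -/
def init (c : TaskComputation P) : Config P :=
  fun i => (c.tree i).map fun τ => (i, τ)

/-- The processors that have work left to do. -/
def busy (s : Config P) : Finset (Fin P) :=
  Finset.univ.filter fun j => (s j).isSome

/-- The free processors. -/
def free (s : Config P) : Finset (Fin P) :=
  Finset.univ.filter fun j => (s j).isNone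

/-- The processors other than `i` that are working on the work of `i`. -/
def helpers (s : Config P) (i : Fin P) : Finset (Fin P) :=
  Finset.univ.filter fun j => j ≠ i ∧ (s j).map Prod.fst = some i

/-- The owners left: the processors whose own work is not completed. -/
def owners (s : Config P) : Finset (Fin P) :=
  Finset.univ.filter fun i => ∃ j, (s j).map Prod.fst = some i

/-- The processors from which the free processor `p` chooses its victim: if other processors are
working on the work of `p`, these processors (steal-back), and otherwise all the processors that
have work left to do (general steal). -/
def targets (s : Config P) (p : Fin P) : Finset (Fin P) :=
  if (s.helpers p).Nonempty then s.helpers p else s.busy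

/-- One timestep from `s` to `s'`, where `v p` is the victim chosen by the free processor `p`.
For each processor `q` that is attacked, one arbitrary attacker `w q` comes through, the other
attackers fail. A thief that comes through gets the branch on which its victim is not working, if
there is one, on behalf of the same owner. A busy processor executes one unit of work. -/
def Step (s : Config P) (v : Fin P → Fin P) (s' : Config P) : Prop :=
  ∃ w : Fin P → Option (Fin P),
    (∀ q p, w q = some p → p ∈ s.free ∧ v p = q) ∧
    (∀ q, (∃ p ∈ s.free, v p = q) → (w q).isSome) ∧
    ∀ p, s' p =
      match s p with
      | none =>
          if w (v p) = some p then
            (s (v p)).bind fun x => x.2.stolen.map fun τ => (x.1, τ)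
          else none
      | some (o, τ) =>
          (if (w p).isSome then τ.kept else τ).exec.map fun τ' => (o, τ')

/-- The free agents (those whose own work is completed; `P - k` of them when `k` owners are left)
are evenly distributed over the work of the owners left: each of these has its share `(P - k) / k`
(up to rounding) of them working on its work, not counting those which are busy stealing. -/
def Even (s : Config P) : Prop :=
  ∀ i ∈ s.owners,
    (s.helpers i).card ≤ ⌈((P : ℚ) - (s.owners.card : ℚ)) / (s.owners.card : ℚ)⌉₊

end Config

/-- `state` is a (random) execution of localized work stealing on the computation `c`, where
`state t` is the configuration after `t` timesteps and `victim t p` is the victim chosen in the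
next timestep by processor `p` if it is free. As long as there is work left, given the past
`ℱ t` the free processors choose their victims independently and uniformly among their targets.
Which of several simultaneous attackers comes through is arbitrary. -/
structure IsExecution {P : ℕ} (c : TaskComputation P) {Ω : Type*} [mΩ : MeasurableSpace Ω]
    (μ : Measure Ω) (ℱ : Filtration ℕ mΩ)
    (state : ℕ → Ω → Config P) (victim : ℕ → Ω → Fin P → Fin P) : Prop where
  init : ∀ ω, state 0 ω = Config.init c
  adapted : ∀ t s, MeasurableSet[ℱ t] {ω | state t ω = s}
  measurable_victim : ∀ t p, Measurable fun ω => victim t ω p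
  uniform : ∀ (t : ℕ) (A : Set Ω), MeasurableSet[ℱ t] A →
    ∀ s : Config P, s.busy.Nonempty →
    ∀ v : Fin P → Fin P, (∀ p ∈ s.free, v p ∈ s.targets p) →
      μ {ω | ω ∈ A ∧ state t ω = s ∧ ∀ p ∈ s.free, victim t ω p = v p}
        = μ {ω | ω ∈ A ∧ state t ω = s} * ∏ p ∈ s.free, ((s.targets p).card : ℝ≥0∞)⁻¹
  step : ∀ t ω, (state t ω).Step (victim t ω) (state (t + 1) ω)

/-- The running time (including the timesteps spent on stealing): the first time at which no
processor has work left, and `∞` if there is no such time. -/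
noncomputable def runningTime {P : ℕ} {Ω : Type*} (state : ℕ → Ω → Config P) (ω : Ω) : ℝ≥0∞ :=
  ⨅ (t : ℕ) (_ : (state t ω).busy = ∅), (t : ℝ≥0∞)

/-- The even distribution of free agents assumption holds throughout the execution `ω`. -/
def EvenDistribution {P : ℕ} {Ω : Type*} (state : ℕ → Ω → Config P) (ω : Ω) : Prop :=
  ∀ t, (state t ω).Even

/-! In a step with work left, each processor either executes a unit of work or makes a steal
attempt. So `P` times the number of such steps is at most `T1` plus the number of attempts, and the
attempts have to be bounded by order `P * lg P * Tinf`.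

A piece of work gets the potential `4 ^ (maxSize + height)`, which at least halves whenever the
piece is attacked (`successorSum_potential_le`). There are `P + 1` potentials: the total one, driven
down by general steals, and one for each owner, driven down by the steal-backs of that owner. The
weight of a step bounds from below the sum of the probabilities with which the relevant thieves hit
a given piece. Hence `exp (accWeight / 5) * (potential + 1)` has nonincreasing expectation
(`lintegral_succ_le`), and the accumulated weight has an exponential moment of at most `4 ^ Tinf +
1`. Summing over all potentials gives `expWeight`, whose logarithm controls all accumulated weights
at once.

The rest is pathwise. General steals cost `P` times their accumulated weight. Under even
distribution with `k` owners left, a steal-back has weight at least `k / P`, so an owner makes at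
most `P * Y / k` of them, where `Y` bounds the accumulated weights and `k` is the least number of
owners left when it steals back. Owners only disappear, so these `k` dominate `1, 2, 3, ...` when
sorted, and a harmonic sum yields the factor `lg P` (`sum_stealsBack_le`). Even distribution enters
only here, never in the probabilistic estimate, so nothing is conditioned on it. -/

namespace TaskTree

/-! ### The potential of a single piece of work. -/

/-- The potential of a piece of work. It at least halves whenever the piece is attacked. -/
def potential (τ : TaskTree) : ℕ := 4 ^ (τ.maxSize + τ.height)

/-- The sum of `f` over what is left, after one timestep, of a piece of work, including the part
that is stolen if the piece is attacked. -/
def successorSum (f : TaskTree → ℕ) (attacked : Prop) [Decidable attacked] (τ : TaskTree) : ℕ :=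
  if attacked then τ.kept.exec.elim 0 f + τ.stolen.elim 0 f else τ.exec.elim 0 f

lemma exec_work (τ : TaskTree) : τ.exec.elim 0 work + 1 = τ.work := by
  induction τ with
  | leaf r => cases r <;> simp [exec, work]
  | node l r ihl _ =>
    cases h : l.exec <;> simp [exec, h, work] at ihl ⊢ <;> omega

lemma exec_maxSize_height (τ τ' : TaskTree) (h : τ.exec = some τ') :
    τ'.maxSize ≤ τ.maxSize ∧ τ'.height ≤ τ.height := by
  induction τ generalizing τ' with
  | leaf r => cases r <;> simp [exec] at h; subst h; simp [maxSize, height]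
  | node l r ihl _ =>
    cases hl : l.exec with
    | none => simp [exec, hl] at h; subst h; simp [maxSize, height]; omega
    | some l' =>
      have := ihl l' hl
      simp [exec, hl] at h; subst h; simp [maxSize, height]; omega

lemma exec_potential_le (τ : TaskTree) : τ.exec.elim 0 potential ≤ τ.potential := by
  cases h : τ.exec with
  | none => simp
  | some τ' =>
    have := exec_maxSize_height τ τ' h
    exact Nat.pow_le_pow_right (by norm_num) (by omega)

lemma successorSum_work (a : Prop) [Decidable a] (τ : TaskTree) :
    τ.successorSum work a + 1 = τ.work := by
  unfold successorSum
  split_ifs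
  · have := exec_work τ.kept
    cases τ <;> simp [kept, stolen, work] at this ⊢ <;> omega
  · exact exec_work τ

/-- Each branch of a node has smaller height, hence at most a quarter of the potential, and an
attack leaves the two branches as separate pieces. -/
lemma successorSum_potential_le (a : Prop) [Decidable a] (τ : TaskTree) :
    2 * τ.successorSum potential a ≤ τ.potential * (if a then 1 else 2) := by
  unfold successorSum
  split_ifs
  · cases τ with
    -- Nothing can be stolen from a single task, but the unit executed lowers `maxSize`. This is why
    -- the exponent contains the size.
    | leaf r =>
      cases r with
      | zero => simp [kept, exec, stolen]
      | succ r =>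
        simp only [kept, exec, stolen, Option.elim, potential, maxSize, height]
        rw [show r + 1 + 1 + 0 = (r + 1 + 0) + 1 by ring, pow_succ 4 (r + 1 + 0)]
        omega
    | node l r =>
      have h1 := exec_potential_le l
      have h2 : l.potential ≤ 4 ^ (max l.maxSize r.maxSize + max l.height r.height) :=
        Nat.pow_le_pow_right (by norm_num) (by omega)
      have h3 : r.potential ≤ 4 ^ (max l.maxSize r.maxSize + max l.height r.height) :=
        Nat.pow_le_pow_right (by norm_num) (by omega)
      have h4 : (node l r).potential
          = 4 ^ (max l.maxSize r.maxSize + max l.height r.height) * 4 := by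
        simp [potential, maxSize, height, ← pow_succ, add_assoc]
      simp only [kept, stolen, Option.elim_some]
      omega
  · have := exec_potential_le τ
    omega

lemma four_le_potential (τ : TaskTree) : 4 ≤ τ.potential := by
  have : 1 ≤ τ.maxSize := by
    induction τ with
    | leaf r => simp [maxSize]
    | node l r ihl _ => simp [maxSize]; omega
  calc 4 = 4 ^ 1 := by norm_num
    _ ≤ _ := Nat.pow_le_pow_right (by norm_num) (by omega)

/-- A code for task trees, which shows that there are only countably many. -/
def code : TaskTree → ℕ
  | leaf r => 2 * r
  | node l r => 2 * Nat.pair l.code r.code + 1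

lemma code_injective : Function.Injective code := by
  intro a
  induction a with
  | leaf r =>
    intro b h
    cases b with
    | leaf r' => simp [code] at h; rw [h]
    | node l' r' => simp [code] at h; omega
  | node l r ihl ihr =>
    intro b h
    cases b with
    | leaf r' => simp [code] at h; omega
    | node l' r' =>
      simp [code, Nat.pair_eq_pair] at h
      rw [ihl h.1, ihr h.2]

instance : Countable TaskTree := code_injective.countable

end TaskTree

/-! ### Work and potential of a configuration under one timestep. -/

namespace Config

variable {P : ℕ}

/-- The sum of `F` over the pieces of work of a configuration. -/
def total (F : Fin P × TaskTree → ℕ) (s : Config P) : ℕ := ∑ p, (s p).elim 0 F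

/-- `q` is attacked by a free processor. -/
def Attacked (s : Config P) (v : Fin P → Fin P) (q : Fin P) : Prop := ∃ p ∈ s.free, v p = q

instance (s : Config P) (v : Fin P → Fin P) (q : Fin P) : Decidable (s.Attacked v q) :=
  inferInstanceAs (Decidable (∃ p ∈ s.free, v p = q))

/-- Stolen pieces are charged to the victim, so that the bound is a sum over the old pieces. It is
stated for general `F` to serve both work and potential. -/
lemma Step.total_le {s s' : Config P} {v : Fin P → Fin P} (h : s.Step v s')
    (F : Fin P × TaskTree → ℕ) :
    s'.total F ≤ ∑ q, (s q).elim 0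
      fun x => x.2.successorSum (fun τ => F (x.1, τ)) (s.Attacked v q) := by
  obtain ⟨w, hw1, hw2, hs⟩ := h
  have hw : ∀ q, (w q).isSome ↔ s.Attacked v q := fun q =>
    ⟨fun hq => by
      obtain ⟨p, hp⟩ := Option.isSome_iff_exists.1 hq
      exact ⟨p, hw1 q p hp⟩, hw2 q⟩
  let g : Fin P → ℕ := fun q => (s q).elim 0 fun x => x.2.stolen.elim 0 fun τ => F (x.1, τ)
  let own : Fin P → ℕ := fun p => (s p).elim 0
    fun x => (if s.Attacked v p then x.2.kept else x.2).exec.elim 0 fun τ => F (x.1, τ)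
  let S : Finset (Fin P) := Finset.univ.filter fun p => w (v p) = some p
  have h1 : ∀ p, (s' p).elim 0 F ≤ own p + if p ∈ S then g (v p) else 0 := by
    intro p
    rw [hs p]
    cases hp : s p with
    | none =>
      by_cases hwp : w (v p) = some p
      · cases hv : s (v p) with
        | none => simp [hwp]
        | some x => cases hx : x.2.stolen <;> simp [hwp, hv, own, g, S, hp, hx]
      · simp [hwp]
    | some x =>
      obtain ⟨o, τ⟩ := x
      simp only [own, hp, Option.elim_some, hw]
      refine le_trans (le_of_eq ?_) (Nat.le_add_right _ _)
      cases (if s.Attacked v p then τ.kept else τ).exec <;> simp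
  have h2 : ∑ p ∈ S, g (v p) ≤ ∑ q, if s.Attacked v q then g q else 0 := by
    rw [← Finset.sum_filter, ← Finset.sum_image (f := g) (g := v)]
    · refine Finset.sum_le_sum_of_subset ?_
      intro q hq
      obtain ⟨p, hp, rfl⟩ := Finset.mem_image.1 hq
      have hp' : w (v p) = some p := (Finset.mem_filter.1 hp).2
      simp [← hw, hp']
    -- Only one attacker of each victim comes through, so `v` is injective on the successful
    -- thieves.
    · intro p hp p' hp' e
      have h1 : w (v p) = some p := (Finset.mem_filter.1 hp).2
      have h2 : w (v p') = some p' := (Finset.mem_filter.1 hp').2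
      rw [← e, h1] at h2
      simpa using h2
  calc s'.total F ≤ ∑ p, (own p + if p ∈ S then g (v p) else 0) :=
        Finset.sum_le_sum fun p _ => h1 p
    _ = ∑ p, own p + ∑ p ∈ S, g (v p) := by
        rw [Finset.sum_add_distrib, Finset.sum_ite_mem, Finset.univ_inter]
    _ ≤ ∑ p, own p + ∑ q, if s.Attacked v q then g q else 0 := by gcongr
    _ = _ := by
        rw [← Finset.sum_add_distrib]
        refine Finset.sum_congr rfl fun q _ => ?_
        cases hq : s q with
        | none => simp [own, g, hq]
        | some x =>
          by_cases ha : s.Attacked v q <;> simp [own, g, hq, ha, TaskTree.successorSum]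

/-- The total work that is left. -/
def work (s : Config P) : ℕ := s.total fun x => x.2.work

/-- The total potential of the pieces of work whose owners belong to `O`. -/
def potential (O : Finset (Fin P)) (s : Config P) : ℕ :=
  s.total fun x => if x.1 ∈ O then x.2.potential else 0

lemma Step.work_add_card_busy_le {s s' : Config P} {v : Fin P → Fin P} (h : s.Step v s') :
    s'.work + s.busy.card ≤ s.work := by
  have h1 := h.total_le fun x => x.2.work
  have h2 : s.busy.card = ∑ q, if (s q).isSome then 1 else 0 := by
    rw [busy, Finset.card_filter]
  calc s'.work + s.busy.card ≤ _ := Nat.add_le_add h1 h2.le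
    _ = s.work := by
      rw [← Finset.sum_add_distrib]
      refine Finset.sum_congr rfl fun q _ => ?_
      cases hq : s q with
      | none => simp
      | some x => simpa using TaskTree.successorSum_work _ x.2

lemma Step.two_mul_potential_le {s s' : Config P} {v : Fin P → Fin P} (h : s.Step v s')
    (O : Finset (Fin P)) :
    2 * s'.potential O ≤ ∑ q, (s q).elim 0 (fun x => if x.1 ∈ O then x.2.potential else 0) *
      (if s.Attacked v q then 1 else 2) := by
  refine (Nat.mul_le_mul_left 2 (h.total_le _)).trans ?_
  rw [Finset.mul_sum]
  refine Finset.sum_le_sum fun q _ => ?_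
  cases hq : s q with
  | none => simp
  | some x =>
    by_cases hx : x.1 ∈ O
    · simpa [hx] using TaskTree.successorSum_potential_le (s.Attacked v q) x.2
    · have : x.2.successorSum (fun _ => 0) (s.Attacked v q) = 0 := by
        unfold TaskTree.successorSum
        split_ifs
        · cases x.2.kept.exec <;> cases x.2.stolen <;> simp
        · cases x.2.exec <;> simp
      simp [hx, this]

lemma Step.owners_subset {s s' : Config P} {v : Fin P → Fin P} (h : s.Step v s') :
    s'.owners ⊆ s.owners := by
  obtain ⟨w, -, -, hs⟩ := h
  intro i hi
  simp only [owners, Finset.mem_filter, Finset.mem_univ, true_and, Option.map_eq_some_iff] at hi ⊢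
  obtain ⟨j, x, hx, rfl⟩ := hi
  rw [hs j] at hx
  cases hj : s j with
  | none =>
    simp only [hj] at hx
    split_ifs at hx
    obtain ⟨y, hy, hyx⟩ := Option.bind_eq_some_iff.1 hx
    obtain ⟨τ, -, rfl⟩ := Option.map_eq_some_iff.1 hyx
    exact ⟨v j, y, hy, rfl⟩
  | some y =>
    obtain ⟨o, τ⟩ := y
    simp only [hj] at hx
    obtain ⟨τ', -, rfl⟩ := Option.map_eq_some_iff.1 hx
    exact ⟨j, (o, τ), hj, rfl⟩

lemma four_le_potential {s : Config P} {O : Finset (Fin P)} {q : Fin P} {x : Fin P × TaskTree}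
    (hq : s q = some x) (hx : x.1 ∈ O) : 4 ≤ s.potential O := by
  refine (TaskTree.four_le_potential x.2).trans ?_
  have := Finset.single_le_sum (f := fun p => (s p).elim 0
    (fun x : Fin P × TaskTree => if x.1 ∈ O then x.2.potential else 0))
    (fun _ _ => Nat.zero_le _) (Finset.mem_univ q)
  simpa [potential, total, hq, hx] using this

lemma work_init (c : TaskComputation P) : (init c).work = c.T1 := by
  unfold work total TaskComputation.T1
  refine Finset.sum_congr rfl fun i _ => ?_
  cases h : c.tree i <;> simp [init, h]

lemma potential_init_le (c : TaskComputation P) (O : Finset (Fin P)) :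
    (init c).potential O ≤ 4 ^ c.Tinf := by
  set h := Finset.univ.sup fun i => (c.tree i).elim 0 TaskTree.height with hh
  set m := Finset.univ.sup fun i => (c.tree i).elim 0 TaskTree.maxSize with hm
  have key : ∀ i, ((init c) i).elim 0
      (fun x : Fin P × TaskTree => if x.1 ∈ O then x.2.potential else 0) ≤ 4 ^ (h + m) := by
    intro i
    cases hi : c.tree i with
    | none => simp [init, hi]
    | some τ =>
      have h1 : τ.height ≤ h := by
        simpa [hi] using Finset.le_sup (f := fun i => (c.tree i).elim 0 TaskTree.height)
          (Finset.mem_univ i)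
      have h2 : τ.maxSize ≤ m := by
        simpa [hi] using Finset.le_sup (f := fun i => (c.tree i).elim 0 TaskTree.maxSize)
          (Finset.mem_univ i)
      simp only [init, hi, Option.map_some, Option.elim_some]
      split_ifs
      · exact Nat.pow_le_pow_right (by norm_num) (by omega)
      · positivity
  calc (init c).potential O ≤ ∑ _i : Fin P, 4 ^ (h + m) := by
        unfold potential total
        exact Finset.sum_le_sum fun i _ => key i
    _ = P * 4 ^ (h + m) := by simp
    -- The number of initial pieces is paid for by the tree of height `⌈lg P⌉` that connects the
    -- roots.
    _ ≤ 4 ^ Nat.clog 2 P * 4 ^ (h + m) := by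
        gcongr
        exact (Nat.le_pow_clog (by norm_num) P).trans (Nat.pow_le_pow_left (by norm_num) _)
    _ = 4 ^ c.Tinf := by rw [← pow_add, TaskComputation.Tinf, add_assoc]

end Config

/-! ### The rate at which tracked pieces are attacked. -/

namespace Config

variable {P : ℕ}

/-- The owners whose work is tracked: all owners for general steals, a single one for its
steal-backs. -/
def tracked : Option (Fin P) → Finset (Fin P)
  | none => Finset.univ
  | some p => {p}

/-- A lower bound for the expected number of tracked steal attempts at each processor that is
working for a tracked owner. -/
noncomputable def weight (s : Config P) : Option (Fin P) → ℝ
  | none => if s.busy.Nonempty then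
      ((s.free.filter fun p => ¬(s.helpers p).Nonempty).card : ℝ) / P else 0
  | some p => if p ∈ s.free ∧ (s.helpers p).Nonempty then ((s.helpers p).card : ℝ)⁻¹ else 0

lemma weight_nonneg (s : Config P) (i : Option (Fin P)) : 0 ≤ s.weight i := by
  cases i <;> simp only [weight] <;> split_ifs <;> positivity

lemma weight_le_one (s : Config P) (i : Option (Fin P)) : s.weight i ≤ 1 := by
  cases i with
  | none =>
    simp only [weight]
    split_ifs
    · refine div_le_one_of_le₀ ?_ (by positivity)
      exact_mod_cast (Finset.card_le_univ _).trans (by simp)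
    · norm_num
  | some p =>
    simp only [weight]
    split_ifs with h
    · exact inv_le_one_of_one_le₀ (by exact_mod_cast h.2.card_pos)
    · norm_num

lemma weight_eq_zero_or_four_le_potential (s : Config P) (i : Option (Fin P)) :
    s.weight i = 0 ∨ 4 ≤ s.potential (tracked i) := by
  cases i with
  | none =>
    by_cases h : s.busy.Nonempty
    · obtain ⟨q, hq⟩ := h
      obtain ⟨x, hx⟩ := Option.isSome_iff_exists.1 (Finset.mem_filter.1 hq).2
      exact Or.inr (four_le_potential hx (Finset.mem_univ _))
    · simp [weight, h]
  | some p =>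
    by_cases h : (s.helpers p).Nonempty
    · obtain ⟨q, hq⟩ := h
      obtain ⟨x, hx, hp⟩ := Option.map_eq_some_iff.1 (Finset.mem_filter.1 hq).2.2
      exact Or.inr (four_le_potential hx (by simp [tracked, hp]))
    · simp [weight, h]

/-- A general thief hits a given busy processor with probability `1 / s.busy.card`, at least `1 /
P`. When `p` steals back it is free itself, so every piece owned by `p` lies with a helper. -/
lemma exists_attackers (s : Config P) (hs : s.busy.Nonempty) (i : Option (Fin P)) :
    ∃ G ⊆ s.free, (∀ q x, s q = some x → x.1 ∈ tracked i → ∀ p ∈ G, q ∈ s.targets p) ∧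
      s.weight i ≤ ∑ p ∈ G, ((s.targets p).card : ℝ)⁻¹ := by
  cases i with
  | none =>
    refine ⟨s.free.filter fun p => ¬(s.helpers p).Nonempty, Finset.filter_subset _ _, ?_, ?_⟩
    · intro q x hq _ p hp
      rw [targets, if_neg (Finset.mem_filter.1 hp).2]
      simp [busy, hq]
    · have hb : (0 : ℝ) < s.busy.card := by exact_mod_cast hs.card_pos
      have hbP : (s.busy.card : ℝ) ≤ P := by
        exact_mod_cast (Finset.card_le_univ s.busy).trans (by simp)
      calc s.weight none = ∑ p ∈ s.free.filter fun p => ¬(s.helpers p).Nonempty, (P : ℝ)⁻¹ := by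
            simp [weight, hs, div_eq_mul_inv]
        _ ≤ _ := Finset.sum_le_sum fun p hp => by
            rw [targets, if_neg (Finset.mem_filter.1 hp).2]
            gcongr
  | some p =>
    by_cases h : p ∈ s.free ∧ (s.helpers p).Nonempty
    · refine ⟨{p}, by simpa using h.1, ?_, by simp [weight, targets, h]⟩
      intro q x hq hx p' hp'
      obtain rfl := Finset.mem_singleton.1 hp'
      rw [targets, if_pos h.2]
      have hfree : s p' = none := by simpa [free] using h.1
      have : q ≠ p' := fun e => by simp [e, hfree] at hq
      simpa [helpers, hq, this, tracked] using hx
    · exact ⟨∅, by simp, by simp, by simp [weight, h]⟩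

end Config

/-! ### Contraction of the expected potential in one timestep. -/

/-- With `exp (-x) ≤ 1 - x / 2` and `exp (-(x / 5)) ≥ 1 - x / 5`, the claim for `x > 0` reduces to
`4 * (Φ + 1) ≤ 5 * Φ`. The rate `1 / 5` thus matches the least positive potential `4`. -/
lemma potential_contraction {x Φ : ℝ} (h0 : 0 ≤ x) (h1 : x ≤ 1) (h : x = 0 ∨ 4 ≤ Φ) :
    Φ * (1 + Real.exp (-x)) + 2 ≤ 2 * (Real.exp (-(x / 5)) * (Φ + 1)) := by
  rcases h with rfl | h
  · simp; linarith
  have e1 : Real.exp (-x) ≤ 1 - x / 2 := by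
    have h2 : (1 - x / 2) * Real.exp x ≥ 1 := by
      have := Real.quadratic_le_exp_of_nonneg h0
      nlinarith [mul_nonneg h0 h0, mul_nonneg (mul_nonneg h0 h0) (sub_nonneg.2 h1)]
    rw [Real.exp_neg, inv_le_iff_one_le_mul₀ (Real.exp_pos x)]
    exact h2
  have e2 : 1 - x / 5 ≤ Real.exp (-(x / 5)) := by
    have := Real.add_one_le_exp (-(x / 5))
    linarith
  have : (1 - x / 5) * (Φ + 1) ≤ Real.exp (-(x / 5)) * (Φ + 1) := by gcongr
  nlinarith [mul_le_mul_of_nonneg_left e1 (by linarith : 0 ≤ Φ), mul_nonneg h0 (sub_nonneg.2 h)]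

/-- This plays the role of conditioning: there are countably many configurations, so an inequality
of expectations can be checked on each history separately. -/
lemma lintegral_le_of_fibers {Ω ι : Type*} [MeasurableSpace Ω] [Countable ι] {μ : Measure Ω}
    {f g : Ω → ℝ≥0∞} (X : Ω → ι) (hX : ∀ i, MeasurableSet {ω | X ω = i})
    (h : ∀ i, ∫⁻ ω in {ω | X ω = i}, f ω ∂μ ≤ ∫⁻ ω in {ω | X ω = i}, g ω ∂μ) :
    ∫⁻ ω, f ω ∂μ ≤ ∫⁻ ω, g ω ∂μ := by
  have hU : ⋃ i, {ω | X ω = i} = Set.univ := by ext; simp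
  have hd : Pairwise (Function.onFun Disjoint fun i => {ω | X ω = i}) := fun i j hij =>
    Set.disjoint_left.2 fun ω hi hj => hij (hi.symm.trans hj)
  rw [← setLIntegral_univ f, ← setLIntegral_univ g, ← hU, lintegral_iUnion hX hd,
    lintegral_iUnion hX hd]
  exact ENNReal.tsum_le_tsum h

namespace IsExecution

open Config

variable {P : ℕ} {c : TaskComputation P} {Ω : Type*} [mΩ : MeasurableSpace Ω]
  {μ : Measure Ω} {ℱ : Filtration ℕ mΩ}
  {state : ℕ → Ω → Config P} {victim : ℕ → Ω → Fin P → Fin P}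

lemma measurableSet_state (h : IsExecution c μ ℱ state victim) (t : ℕ) (s : Config P) :
    MeasurableSet {ω | state t ω = s} := ℱ.le t _ (h.adapted t s)

lemma measurableSet_victim (h : IsExecution c μ ℱ state victim) (t : ℕ) (p q : Fin P) :
    MeasurableSet {ω | victim t ω p = q} :=
  h.measurable_victim t p (measurableSet_singleton q)

lemma measurableSet_attacked (h : IsExecution c μ ℱ state victim) (t : ℕ) (s : Config P)
    (q : Fin P) : MeasurableSet {ω | s.Attacked (victim t ω) q} := by
  have : {ω | s.Attacked (victim t ω) q} = ⋃ p ∈ s.free, {ω | victim t ω p = q} := by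
    ext ω; simp [Attacked]
  rw [this]
  exact Finset.measurableSet_biUnion _ fun p _ => h.measurableSet_victim t p q

/-- The victims of the free processors are independent and uniform among the targets. -/
lemma measure_victim_mem (h : IsExecution c μ ℱ state victim) {t : ℕ} {A : Set Ω}
    (hA : MeasurableSet[ℱ t] A) {s : Config P} (hs : s.busy.Nonempty)
    (B : Fin P → Finset (Fin P)) (hB : ∀ p ∈ s.free, B p ⊆ s.targets p) :
    μ {ω | ω ∈ A ∧ state t ω = s ∧ ∀ p ∈ s.free, victim t ω p ∈ B p}
      = μ {ω | ω ∈ A ∧ state t ω = s}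
        * ∏ p ∈ s.free, ((B p).card * ((s.targets p).card : ℝ≥0∞)⁻¹) := by
  -- Busy processors get the dummy value `p`, so that distinct members of `V` describe disjoint
  -- events and only free processors contribute to the count.
  let V := Fintype.piFinset fun p => if p ∈ s.free then B p else {p}
  have hV : ∀ v ∈ V, ∀ p, if p ∈ s.free then v p ∈ B p else v p = p := by
    intro v hv p
    have := Fintype.mem_piFinset.1 hv p
    split_ifs at this ⊢
    · exact this
    · simpa using this
  have hU : {ω | ω ∈ A ∧ state t ω = s ∧ ∀ p ∈ s.free, victim t ω p ∈ B p}
      = ⋃ v ∈ V, {ω | ω ∈ A ∧ state t ω = s ∧ ∀ p ∈ s.free, victim t ω p = v p} := by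
    ext ω
    simp only [Set.mem_ofPred_eq, Set.mem_iUnion, exists_prop]
    constructor
    · rintro ⟨h1, h2, h3⟩
      refine ⟨fun p => if p ∈ s.free then victim t ω p else p, ?_, h1, h2, ?_⟩
      · refine Fintype.mem_piFinset.2 fun p => ?_
        split_ifs with hp
        · exact h3 p hp
        · simp
      · intro p hp
        simp [hp]
    · rintro ⟨v, hv, h1, h2, h3⟩
      refine ⟨h1, h2, fun p hp => ?_⟩
      rw [h3 p hp]
      simpa [hp] using hV v hv p
  rw [hU, measure_biUnion_finset]
  · rw [Finset.sum_congr rfl fun v hv => h.uniform t A hA s hs v fun p hp =>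
      hB p hp (by simpa [hp] using hV v hv p), Finset.sum_const, Fintype.card_piFinset]
    have : ∏ p, (if p ∈ s.free then B p else {p}).card = ∏ p ∈ s.free, (B p).card := by
      rw [← Finset.prod_subset (Finset.subset_univ s.free)]
      · exact Finset.prod_congr rfl fun p hp => by rw [if_pos hp]
      · intro p _ hp
        rw [if_neg hp, Finset.card_singleton]
    rw [this, Finset.prod_mul_distrib, nsmul_eq_mul]
    push_cast
    ring
  · intro v hv v' hv' hne
    refine Set.disjoint_left.2 fun ω h1 h2 => hne ?_
    funext p
    by_cases hp : p ∈ s.free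
    · rw [← h1.2.2 p hp, h2.2.2 p hp]
    · have e1 := hV v hv p
      have e2 := hV v' hv' p
      rw [if_neg hp] at e1 e2
      rw [e1, e2]
  · intro v _
    have : {ω | ω ∈ A ∧ state t ω = s ∧ ∀ p ∈ s.free, victim t ω p = v p}
        = A ∩ ({ω | state t ω = s} ∩ ⋂ p ∈ s.free, {ω | victim t ω p = v p}) := by
      ext ω; simp; tauto
    rw [this]
    exact (ℱ.le t _ hA).inter ((h.measurableSet_state t s).inter
      (Finset.measurableSet_biInter _ fun p _ => h.measurableSet_victim t p _))

/-- By independence the probability is at most the product of the factors `1 - 1 / (s.targets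
p).card` over `G`, and `1 - y ≤ exp (-y)`. -/
lemma measure_not_attacked_le [IsFiniteMeasure μ] (h : IsExecution c μ ℱ state victim) {t : ℕ}
    {A : Set Ω} (hA : MeasurableSet[ℱ t] A) {s : Config P} (hs : s.busy.Nonempty)
    {G : Finset (Fin P)} (hG : G ⊆ s.free) {q : Fin P} (hq : ∀ p ∈ G, q ∈ s.targets p) :
    μ {ω | (ω ∈ A ∧ state t ω = s) ∧ ¬ s.Attacked (victim t ω) q}
      ≤ μ {ω | ω ∈ A ∧ state t ω = s}
        * ENNReal.ofReal (Real.exp (-∑ p ∈ G, ((s.targets p).card : ℝ)⁻¹)) := by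
  have hT : ∀ p, (s.targets p).Nonempty := fun p => by
    unfold targets
    split_ifs with h
    · exact h
    · exact hs
  have hfull := h.measure_victim_mem hA hs s.targets fun _ _ => subset_rfl
  have hone : ∏ p ∈ s.free, ((s.targets p).card * ((s.targets p).card : ℝ≥0∞)⁻¹) = 1 :=
    Finset.prod_eq_one fun p _ =>
      ENNReal.mul_inv_cancel (by simpa using (hT p).ne_empty) (by simp)
  rw [hone, mul_one] at hfull
  let F := {ω | ω ∈ A ∧ state t ω = s ∧ ∀ p ∈ s.free, victim t ω p ∈ s.targets p}
  let S := {ω | ω ∈ A ∧ state t ω = s}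
  have hFm : MeasurableSet F := by
    have : F = A ∩ ({ω | state t ω = s} ∩
        ⋂ p ∈ s.free, ⋃ q ∈ s.targets p, {ω | victim t ω p = q}) := by
      ext ω; simp [F]; tauto
    rw [this]
    exact (ℱ.le t _ hA).inter ((h.measurableSet_state t s).inter
      (Finset.measurableSet_biInter _ fun p _ => Finset.measurableSet_biUnion _ fun q _ =>
        h.measurableSet_victim t p q))
  -- That victims are targets is not part of `IsExecution`. It holds almost surely because the
  -- probabilities of the target choices add up to one.
  have hnull : μ (S \ F) = 0 := by
    have hFS : F ⊆ S := fun ω hω => ⟨hω.1, hω.2.1⟩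
    rw [measure_sdiff hFS hFm.nullMeasurableSet (measure_ne_top _ _)]
    exact tsub_eq_zero_of_le hfull.ge
  let B : Fin P → Finset (Fin P) := fun p => if p ∈ G then (s.targets p).erase q else s.targets p
  have hB := h.measure_victim_mem hA hs B fun p _ => by
    simp only [B]
    split_ifs
    · exact Finset.erase_subset _ _
    · exact subset_rfl
  have hsub : {ω | (ω ∈ A ∧ state t ω = s) ∧ ¬ s.Attacked (victim t ω) q}
      ⊆ {ω | ω ∈ A ∧ state t ω = s ∧ ∀ p ∈ s.free, victim t ω p ∈ B p} ∪ (S \ F) := by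
    rintro ω ⟨⟨h1, h2⟩, h3⟩
    by_cases hω : ω ∈ F
    · refine Or.inl ⟨h1, h2, fun p hp => ?_⟩
      have := hω.2.2 p hp
      simp only [B]
      split_ifs
      · exact Finset.mem_erase.2 ⟨fun e => h3 ⟨p, hp, e⟩, this⟩
      · exact this
    · exact Or.inr ⟨⟨h1, h2⟩, hω⟩
  refine (measure_mono hsub).trans ((measure_union_le _ _).trans ?_)
  rw [hnull, add_zero, hB]
  gcongr
  have hexp : Real.exp (-∑ p ∈ G, ((s.targets p).card : ℝ)⁻¹)
      = ∏ p ∈ s.free, Real.exp (-(if p ∈ G then ((s.targets p).card : ℝ)⁻¹ else 0)) := by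
    rw [← Real.exp_sum, Finset.sum_neg_distrib, Finset.sum_ite_mem,
      Finset.inter_eq_right.2 hG]
  rw [hexp, ENNReal.ofReal_prod_of_nonneg fun _ _ => (Real.exp_pos _).le]
  refine Finset.prod_le_prod' fun p _ => ?_
  have hpos : (0 : ℝ) < (s.targets p).card := by exact_mod_cast (hT p).card_pos
  have hconv : ((B p).card : ℝ≥0∞) * ((s.targets p).card : ℝ≥0∞)⁻¹
      = ENNReal.ofReal ((B p).card * ((s.targets p).card : ℝ)⁻¹) := by
    rw [ENNReal.ofReal_mul (by positivity), ENNReal.ofReal_inv_of_pos hpos]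
    simp
  rw [hconv]
  refine ENNReal.ofReal_le_ofReal ?_
  by_cases hp : p ∈ G
  · have hc : ((B p).card : ℝ) = (s.targets p).card - 1 := by
      simp only [B, if_pos hp]
      rw [Finset.card_erase_of_mem (hq p hp), Nat.cast_sub (hT p).card_pos]
      simp
    rw [hc, if_pos hp, sub_mul, mul_inv_cancel₀ hpos.ne', one_mul]
    have := Real.add_one_le_exp (-((s.targets p).card : ℝ)⁻¹)
    linarith
  · simp [B, hp, hpos.ne']

/-- A piece contributes to twice the new potential at most its old potential, and once more that
potential if it is not attacked. Averaging over the attacks and applying `potential_contraction`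
gives the bound. -/
lemma setLIntegral_potential_le [IsFiniteMeasure μ] (h : IsExecution c μ ℱ state victim) {t : ℕ}
    {A : Set Ω} (hA : MeasurableSet[ℱ t] A) (s : Config P) (i : Option (Fin P)) :
    ∫⁻ ω in {ω | ω ∈ A ∧ state t ω = s}, ((state (t + 1) ω).potential (tracked i) + 1 : ℝ≥0∞) ∂μ
      ≤ μ {ω | ω ∈ A ∧ state t ω = s} *
        (ENNReal.ofReal (Real.exp (-(s.weight i / 5))) * (s.potential (tracked i) + 1)) := by
  set S := {ω | ω ∈ A ∧ state t ω = s} with hS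
  have hSm : MeasurableSet S := (ℱ.le t _ hA).inter (h.measurableSet_state t s)
  let φ : Fin P → ℕ := fun q => (s q).elim 0
    fun x => if x.1 ∈ tracked i then x.2.potential else 0
  let U : Fin P → Set Ω := fun q => {ω | ¬ s.Attacked (victim t ω) q}
  have hUm : ∀ q, MeasurableSet (U q) := fun q => (h.measurableSet_attacked t s q).compl
  have hφ : ∑ q, φ q = s.potential (tracked i) := rfl
  have hpt : ∀ ω ∈ S, 2 * ((state (t + 1) ω).potential (tracked i) + 1 : ℝ≥0∞)
      ≤ ∑ q, (φ q : ℝ≥0∞) * (1 + (U q).indicator 1 ω) + 2 := by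
    intro ω hω
    have h1 := (h.step t ω).two_mul_potential_le (tracked i)
    rw [hω.2] at h1
    rw [mul_add, mul_one]
    gcongr
    have h2 : (2 * (state (t + 1) ω).potential (tracked i) : ℝ≥0∞)
        ≤ ∑ q, (φ q : ℝ≥0∞) * ((if s.Attacked (victim t ω) q then 1 else 2 : ℕ) : ℝ≥0∞) := by
      exact_mod_cast h1
    refine h2.trans (le_of_eq (Finset.sum_congr rfl fun q _ => ?_))
    by_cases ha : s.Attacked (victim t ω) q <;> simp [U, ha, one_add_one_eq_two]
  have hU : ∀ q, (φ q : ℝ≥0∞) * μ (S ∩ U q)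
      ≤ φ q * (μ S * ENNReal.ofReal (Real.exp (-s.weight i))) := by
    intro q
    cases hq : s q with
    | none => simp [φ, hq]
    | some x =>
      by_cases hx : x.1 ∈ tracked i
      · have hs : s.busy.Nonempty := ⟨q, by simp [busy, hq]⟩
        obtain ⟨G, hG, hGT, hw⟩ := s.exists_attackers hs i
        gcongr
        refine (h.measure_not_attacked_le hA hs hG (hGT q x hq hx)).trans ?_
        gcongr
      · simp [φ, hq, hx]
  have hreal : (s.potential (tracked i) : ℝ≥0∞) * (1 + ENNReal.ofReal (Real.exp (-s.weight i)))
      + 2 ≤ 2 * (ENNReal.ofReal (Real.exp (-(s.weight i / 5))) *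
        (s.potential (tracked i) + 1)) := by
    have := potential_contraction (Φ := s.potential (tracked i)) (s.weight_nonneg i)
      (s.weight_le_one i) ((s.weight_eq_zero_or_four_le_potential i).imp id
        fun h => by exact_mod_cast h)
    have := ENNReal.ofReal_le_ofReal this
    rw [ENNReal.ofReal_add (by positivity) (by positivity), ENNReal.ofReal_mul (by positivity),
      ENNReal.ofReal_mul (by positivity), ENNReal.ofReal_mul (by positivity),
      ENNReal.ofReal_add (by positivity) (by positivity),
      ENNReal.ofReal_add (by positivity) (by positivity)] at this
    simpa using this
  have h2 : 2 * ∫⁻ ω in S, ((state (t + 1) ω).potential (tracked i) + 1 : ℝ≥0∞) ∂μ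
      ≤ 2 * (μ S * (ENNReal.ofReal (Real.exp (-(s.weight i / 5))) *
        (s.potential (tracked i) + 1))) := by
    rw [← lintegral_const_mul' _ _ (by simp)]
    calc ∫⁻ ω in S, 2 * ((state (t + 1) ω).potential (tracked i) + 1 : ℝ≥0∞) ∂μ
        ≤ ∫⁻ ω in S, (∑ q, (φ q : ℝ≥0∞) * (1 + (U q).indicator 1 ω) + 2) ∂μ :=
          setLIntegral_mono' hSm hpt
      _ = ∑ q, (φ q : ℝ≥0∞) * (μ S + μ (S ∩ U q)) + 2 * μ S := by
          have hm : ∀ q, Measurable fun ω => (U q).indicator (1 : Ω → ℝ≥0∞) ω :=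
            fun q => measurable_one.indicator (hUm q)
          rw [lintegral_add_right _ measurable_const, setLIntegral_const,
            lintegral_finsetSum _ fun q _ => ((hm q).const_add 1).const_mul _]
          congr 1
          refine Finset.sum_congr rfl fun q _ => ?_
          rw [lintegral_const_mul _ ((hm q).const_add 1), lintegral_add_right _ (hm q),
            lintegral_indicator_one (hUm q), Measure.restrict_apply (hUm q), setLIntegral_one,
            Set.inter_comm]
      _ ≤ ∑ q, (φ q : ℝ≥0∞) * (μ S * (1 + ENNReal.ofReal (Real.exp (-s.weight i))))
            + 2 * μ S := by
          refine add_le_add_left (Finset.sum_le_sum fun q _ => ?_) _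
          rw [mul_add, mul_add, mul_one, mul_add]
          exact add_le_add_right (hU q) _
      _ = μ S * (s.potential (tracked i) * (1 + ENNReal.ofReal (Real.exp (-s.weight i))) + 2) := by
          rw [← Finset.sum_mul, ← hφ]
          push_cast
          ring
      _ ≤ μ S * (2 * (ENNReal.ofReal (Real.exp (-(s.weight i / 5))) *
            (s.potential (tracked i) + 1))) := by gcongr
      _ = _ := by ring
  exact (ENNReal.mul_le_mul_iff_right (by simp) (by simp)).1 h2

end IsExecution

/-! ### The exponential supermartingale. -/

/-- The accumulated weight of the first `n` timesteps. -/
noncomputable def accWeight {P : ℕ} {Ω : Type*} (state : ℕ → Ω → Config P) (i : Option (Fin P))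
    (n : ℕ) (ω : Ω) : ℝ := ∑ u ∈ Finset.range n, (state u ω).weight i

namespace IsExecution

open Config

variable {P : ℕ} {c : TaskComputation P} {Ω : Type*} [mΩ : MeasurableSpace Ω]
  {μ : Measure Ω} {ℱ : Filtration ℕ mΩ}
  {state : ℕ → Ω → Config P} {victim : ℕ → Ω → Fin P → Fin P}

lemma lintegral_succ_le [IsFiniteMeasure μ] (h : IsExecution c μ ℱ state victim)
    (i : Option (Fin P)) (n : ℕ) :
    ∫⁻ ω, ENNReal.ofReal (Real.exp (accWeight state i (n + 1) ω / 5)) *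
        ((state (n + 1) ω).potential (tracked i) + 1) ∂μ
      ≤ ∫⁻ ω, ENNReal.ofReal (Real.exp (accWeight state i n ω / 5)) *
        ((state n ω).potential (tracked i) + 1) ∂μ := by
  -- On a fiber of the whole history the accumulated weights are constants and leave the integral.
  let X : Ω → Fin (n + 1) → Config P := fun ω u => state u ω
  have hX : ∀ x, MeasurableSet[ℱ n] {ω | X ω = x} := by
    intro x
    have : {ω | X ω = x} = ⋂ u : Fin (n + 1), {ω | state u ω = x u} := by
      ext ω; simp [X, funext_iff]
    rw [this]
    exact MeasurableSet.iInter fun u => ℱ.mono (Nat.lt_succ_iff.1 u.2) _ (h.adapted u (x u))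
  refine lintegral_le_of_fibers X (fun x => ℱ.le n _ (hX x)) fun x => ?_
  set s := x (Fin.last n)
  have hS : {ω | X ω = x} = {ω | ω ∈ {ω | X ω = x} ∧ state n ω = s} := by
    ext ω
    exact ⟨fun hω => ⟨hω, congrFun hω (Fin.last n)⟩, fun hω => hω.1⟩
  have hlin := h.setLIntegral_potential_le (hX x) s i
  rw [← hS] at hlin
  have hm := ℱ.le n _ (hX x)
  let y : ℝ := ∑ u : Fin n, (x u.castSucc).weight i
  have hy : ∀ ω ∈ {ω | X ω = x}, accWeight state i n ω = y := by
    rintro ω rfl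
    rw [accWeight, Finset.sum_range]
    rfl
  have hy' : ∀ ω ∈ {ω | X ω = x}, accWeight state i (n + 1) ω = y + s.weight i := by
    intro ω hω
    rw [← hy ω hω, accWeight, Finset.sum_range_succ, ← accWeight]
    rw [show state n ω = s from congrFun hω (Fin.last n)]
  calc _ = ∫⁻ ω in {ω | X ω = x}, ENNReal.ofReal (Real.exp ((y + s.weight i) / 5)) *
        ((state (n + 1) ω).potential (tracked i) + 1) ∂μ :=
        setLIntegral_congr_fun hm fun ω hω => by simp only [hy' ω hω]
    _ = ENNReal.ofReal (Real.exp ((y + s.weight i) / 5)) *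
        ∫⁻ ω in {ω | X ω = x}, ((state (n + 1) ω).potential (tracked i) + 1) ∂μ :=
        lintegral_const_mul' _ _ (by simp)
    _ ≤ ENNReal.ofReal (Real.exp ((y + s.weight i) / 5)) * (μ {ω | X ω = x} *
        (ENNReal.ofReal (Real.exp (-(s.weight i / 5))) * (s.potential (tracked i) + 1))) := by
        gcongr
    _ = (ENNReal.ofReal (Real.exp ((y + s.weight i) / 5)) *
        ENNReal.ofReal (Real.exp (-(s.weight i / 5)))) * (s.potential (tracked i) + 1) *
        μ {ω | X ω = x} := by ring
    _ = ENNReal.ofReal (Real.exp (y / 5)) * (s.potential (tracked i) + 1) *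
        μ {ω | X ω = x} := by
        rw [← ENNReal.ofReal_mul (Real.exp_pos _).le, ← Real.exp_add]
        congr 4
        ring
    _ = ∫⁻ ω in {ω | X ω = x}, ENNReal.ofReal (Real.exp (y / 5)) *
        (s.potential (tracked i) + 1) ∂μ := (setLIntegral_const _ _).symm
    _ = _ := setLIntegral_congr_fun hm fun ω hω => by
        simp only [hy ω hω, show state n ω = s from congrFun hω (Fin.last n)]

/-- The summand `1` next to the potential lets the exponential survive after the potential has
vanished. -/
lemma lintegral_exp_accWeight_le [IsProbabilityMeasure μ] (h : IsExecution c μ ℱ state victim)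
    (i : Option (Fin P)) (n : ℕ) :
    ∫⁻ ω, ENNReal.ofReal (Real.exp (accWeight state i n ω / 5)) ∂μ ≤ 4 ^ c.Tinf + 1 := by
  calc _ ≤ ∫⁻ ω, ENNReal.ofReal (Real.exp (accWeight state i n ω / 5)) *
        ((state n ω).potential (tracked i) + 1) ∂μ :=
        lintegral_mono fun ω => le_mul_of_one_le_right' (by simp)
    _ ≤ ∫⁻ ω, ENNReal.ofReal (Real.exp (accWeight state i 0 ω / 5)) *
        ((state 0 ω).potential (tracked i) + 1) ∂μ := by
        induction n with
        | zero => rfl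
        | succ n ih => exact (h.lintegral_succ_le i n).trans ih
    _ = (Config.init c).potential (tracked i) + 1 := by simp [accWeight, h.init]
    _ ≤ _ := by
        gcongr
        exact_mod_cast potential_init_le c (tracked i)

end IsExecution

/-! ### Ingredients for counting steal attempts. -/

/-- The hypothesis forces the largest value of `K` to be at least the size of `S`. Removing an
element with this value gives the induction. -/
lemma sum_inv_le_harmonic {α : Type*} [DecidableEq α] (S : Finset α) (K : α → ℕ)
    (h : ∀ r, (S.filter fun a => K a ≤ r).card ≤ r) :
    ∑ a ∈ S, ((K a : ℚ))⁻¹ ≤ harmonic S.card := by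
  induction hn : S.card generalizing S with
  | zero => simp [Finset.card_eq_zero.1 hn]
  | succ n ih =>
    obtain ⟨a, ha, hmax⟩ := S.exists_max_image K (Finset.card_pos.1 (by omega))
    have hc : (S.erase a).card = n := by rw [Finset.card_erase_of_mem ha, hn]; rfl
    have h1 := ih (S.erase a) (fun r => (Finset.card_le_card
      (Finset.filter_subset_filter _ (Finset.erase_subset _ _))).trans (h r)) hc
    have hK : n + 1 ≤ K a := by
      have := h (K a)
      rwa [Finset.filter_true_of_mem hmax, hn] at this
    rw [← Finset.sum_erase_add _ _ ha, harmonic_succ]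
    gcongr

namespace Config

variable {P : ℕ}

/-- `p` makes a steal-back attempt. -/
def StealsBack (s : Config P) (p : Fin P) : Prop := p ∈ s.free ∧ (s.helpers p).Nonempty

instance (s : Config P) (p : Fin P) : Decidable (s.StealsBack p) :=
  inferInstanceAs (Decidable (_ ∧ _))

lemma StealsBack.mem_owners {s : Config P} {p : Fin P} (h : s.StealsBack p) : p ∈ s.owners := by
  obtain ⟨j, hj⟩ := h.2
  exact Finset.mem_filter.2 ⟨Finset.mem_univ _, j, (Finset.mem_filter.1 hj).2.2⟩

/-- Rounding up adds less than one, so with `k` owners left there are at most `(P - k) / k + 1 = P /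
k` helpers. -/
lemma StealsBack.weight_ge {s : Config P} {p : Fin P} (h : s.StealsBack p) (he : s.Even) :
    (s.owners.card : ℝ) / P ≤ s.weight (some p) := by
  have hp := h.mem_owners
  have hk : 0 < s.owners.card := Finset.card_pos.2 ⟨p, hp⟩
  have hkP : s.owners.card ≤ P := (Finset.card_le_univ _).trans (by simp)
  have hk' : (0 : ℚ) < s.owners.card := by exact_mod_cast hk
  have hkP' : (s.owners.card : ℚ) ≤ P := by exact_mod_cast hkP
  have h1 : ((s.helpers p).card : ℚ) ≤ P / s.owners.card := by
    have h2 := Nat.ceil_lt_add_one (a := ((P : ℚ) - s.owners.card) / s.owners.card)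
      (div_nonneg (sub_nonneg.2 hkP') hk'.le)
    rw [sub_div, div_self hk'.ne', sub_add_cancel] at h2
    refine le_trans ?_ h2.le
    have := he p hp
    rw [sub_div, div_self hk'.ne'] at this
    exact_mod_cast this
  have h2 : ((s.helpers p).card : ℝ) ≤ P / s.owners.card := by
    have := (Rat.cast_le (K := ℝ)).2 h1
    push_cast at this
    exact this
  have hc : (0 : ℝ) < (s.helpers p).card := by exact_mod_cast h.2.card_pos
  rw [weight, if_pos (show p ∈ s.free ∧ (s.helpers p).Nonempty from h), ← inv_div]
  exact inv_anti₀ hc h2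

lemma card_busy_add_card_free (s : Config P) : s.busy.card + s.free.card = P := by
  have := Finset.card_filter_add_card_filter_not (s := (Finset.univ : Finset (Fin P)))
    (fun j => (s j).isSome)
  simpa [busy, free] using this

lemma card_free_eq (s : Config P) (h : s.busy.Nonempty) :
    (s.free.card : ℝ) = P * s.weight none + ∑ p, if s.StealsBack p then 1 else 0 := by
  have hP : (0 : ℝ) < P := by
    obtain ⟨q, -⟩ := h
    exact_mod_cast q.pos
  have h1 := Finset.card_filter_add_card_filter_not (s := s.free)
    (fun p => (s.helpers p).Nonempty)
  have h2 : (Finset.univ.filter s.StealsBack) = s.free.filter fun p => (s.helpers p).Nonempty := by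
    ext p; simp [StealsBack]
  rw [← h1, Finset.sum_boole, h2, weight, if_pos h, mul_div_cancel₀ _ hP.ne']
  push_cast
  ring

lemma weight_eq_zero_of_one (s : Config 1) (i : Option (Fin 1)) : s.weight i = 0 := by
  cases i with
  | none =>
    by_cases h : s.busy.Nonempty
    · have h1 := s.card_busy_add_card_free
      have h2 := h.card_pos
      have h3 : s.free = ∅ := Finset.card_eq_zero.1 (by omega)
      simp [weight, h3]
    · simp [weight, h]
  | some p =>
    have : s.helpers p = ∅ := by
      ext j; simp [helpers, Subsingleton.elim j p]
    simp [weight, this]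

end Config

/-! ### Truncated running time and logarithmic estimates. -/

lemma logb_le_Tinf {P : ℕ} (c : TaskComputation P) (hP : 1 ≤ P) :
    Real.logb 2 P ≤ c.Tinf := by
  have hP' : (0 : ℝ) < P := by exact_mod_cast hP
  have h1 : (P : ℝ) ≤ 2 ^ Nat.clog 2 P := by
    exact_mod_cast Nat.le_pow_clog (by norm_num) P
  calc Real.logb 2 P ≤ Real.logb 2 (2 ^ Nat.clog 2 P) :=
        Real.logb_le_logb_of_le (by norm_num) hP' h1
    _ = Nat.clog 2 P := by
        rw [Real.logb_pow, Real.logb_self_eq_one (by norm_num), mul_one]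
    _ ≤ c.Tinf := by
        unfold TaskComputation.Tinf
        push_cast
        nlinarith [(Finset.univ.sup fun i => (c.tree i).elim 0 TaskTree.height).cast_nonneg (α := ℝ),
          (Finset.univ.sup fun i => (c.tree i).elim 0 TaskTree.maxSize).cast_nonneg (α := ℝ)]

/-- The number of the first `n` timesteps in which there is work left. -/
def busySteps {P : ℕ} {Ω : Type*} (state : ℕ → Ω → Config P) (n : ℕ) (ω : Ω) : ℕ :=
  ((Finset.range n).filter fun u => (state u ω).busy.Nonempty).card

lemma busySteps_mono {P : ℕ} {Ω : Type*} (state : ℕ → Ω → Config P) (ω : Ω) :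
    Monotone fun n => busySteps state n ω := fun _ _ h =>
  Finset.card_le_card (Finset.filter_subset_filter _ (Finset.range_mono h))

/-- The truncations `busySteps` are finite and measurable, and they increase with `n`. Bounds
uniform in `n` therefore pass to the running time, which need not be finite a priori. -/
lemma runningTime_le_iSup_busySteps {P : ℕ} {Ω : Type*} (state : ℕ → Ω → Config P) (ω : Ω) :
    runningTime state ω ≤ ⨆ n, (busySteps state n ω : ℝ≥0∞) := by
  have hfull : ∀ n, (∀ u < n, (state u ω).busy.Nonempty) → busySteps state n ω = n := by
    intro n hn
    rw [busySteps, Finset.filter_true_of_mem fun u hu => hn u (Finset.mem_range.1 hu),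
      Finset.card_range]
  by_cases h : ∃ t, (state t ω).busy = ∅
  · refine (iInf₂_le (Nat.find h) (Nat.find_spec h)).trans ?_
    refine le_trans (le_of_eq ?_) (le_iSup _ (Nat.find h))
    rw [hfull _ fun u hu => Finset.nonempty_iff_ne_empty.2 (Nat.find_min h hu)]
  · push Not at h
    have : (⨆ n : ℕ, (busySteps state n ω : ℝ≥0∞)) = ⊤ := by
      simp_rw [fun n => hfull n fun u _ => h u]
      exact ENNReal.iSup_natCast
    simp [this]

lemma log_bound {P T : ℝ} (hP : 2 ≤ P) (hT : 1 ≤ T) {ε : ℝ} (hε : 0 < ε) :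
    Real.log ((P + 1) * (4 ^ T + 1) / ε) ≤ Real.log (P / ε) + 4 * T := by
  have h4 : (1 : ℝ) ≤ 4 ^ T := Real.one_le_rpow (by norm_num) (by linarith)
  have h1 : (P + 1) * (4 ^ T + 1) / ε ≤ P / ε * (4 * 4 ^ T) := by
    rw [div_mul_eq_mul_div]
    have h2 : (P + 1) * (4 ^ T + 1) ≤ 2 * P * (2 * 4 ^ T) := by gcongr <;> linarith
    have h3 : (P + 1) * (4 ^ T + 1) ≤ P * (4 * 4 ^ T) := by linarith
    gcongr
  have hlog2 : Real.log 2 < 1 := by linarith [Real.log_two_lt_d9]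
  have hlog4 : Real.log 4 = 2 * Real.log 2 := by
    rw [show (4 : ℝ) = 2 ^ 2 by norm_num, Real.log_pow]
    norm_num
  calc _ ≤ Real.log (P / ε * (4 * 4 ^ T)) := Real.log_le_log (by positivity) h1
    _ = Real.log (P / ε) + (Real.log 4 + T * Real.log 4) := by
      rw [Real.log_mul (by positivity) (by positivity), Real.log_mul (by norm_num) (by positivity),
        Real.log_rpow (by norm_num)]
    _ ≤ _ := by
      rw [hlog4]
      nlinarith

lemma log_le_logb_two {x : ℝ} (hx : 1 ≤ x) : Real.log x ≤ Real.logb 2 x := by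
  have hlog2 : Real.log 2 ≤ 1 := by linarith [Real.log_two_lt_d9]
  exact (le_div_iff₀ (Real.log_pos (by norm_num))).2
    (mul_le_of_le_one_right (Real.log_nonneg hx) hlog2)

/-- The sum of the exponentials of the accumulated weights. -/
noncomputable def expWeight {P : ℕ} {Ω : Type*} (state : ℕ → Ω → Config P) (n : ℕ) (ω : Ω) : ℝ :=
  ∑ i, Real.exp (accWeight state i n ω / 5)

lemma accWeight_nonneg {P : ℕ} {Ω : Type*} (state : ℕ → Ω → Config P) (i : Option (Fin P))
    (n : ℕ) (ω : Ω) : 0 ≤ accWeight state i n ω :=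
  Finset.sum_nonneg fun u _ => (state u ω).weight_nonneg i

lemma accWeight_le_log_expWeight {P : ℕ} {Ω : Type*} (state : ℕ → Ω → Config P)
    (i : Option (Fin P)) (n : ℕ) (ω : Ω) :
    accWeight state i n ω ≤ 5 * Real.log (expWeight state n ω) := by
  have h : Real.exp (accWeight state i n ω / 5) ≤ expWeight state n ω :=
    Finset.single_le_sum (f := fun i => Real.exp (accWeight state i n ω / 5))
      (fun _ _ => (Real.exp_pos _).le) (Finset.mem_univ i)
  have := (Real.le_log_iff_exp_le ((Real.exp_pos _).trans_le h)).2 h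
  linarith

lemma expWeight_pos {P : ℕ} {Ω : Type*} (state : ℕ → Ω → Config P) (n : ℕ) (ω : Ω) :
    0 < expWeight state n ω :=
  Finset.sum_pos (fun _ _ => Real.exp_pos _) ⟨none, Finset.mem_univ _⟩

/-! ### From accumulated weights to the running time. -/

namespace IsExecution

open Config

variable {P : ℕ} {c : TaskComputation P} {Ω : Type*} [mΩ : MeasurableSpace Ω]
  {μ : Measure Ω} {ℱ : Filtration ℕ mΩ}
  {state : ℕ → Ω → Config P} {victim : ℕ → Ω → Fin P → Fin P}

lemma measurable_state (h : IsExecution c μ ℱ state victim) {β : Type*} [MeasurableSpace β]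
    (F : Config P → β) (t : ℕ) : Measurable fun ω => F (state t ω) := by
  intro B _
  have : (fun ω => F (state t ω)) ⁻¹' B = ⋃ s ∈ F ⁻¹' B, {ω | state t ω = s} := by
    ext ω; simp
  rw [this]
  exact MeasurableSet.biUnion (Set.to_countable _) fun s _ => h.measurableSet_state t s

lemma measurableSet_evenDistribution (h : IsExecution c μ ℱ state victim) :
    MeasurableSet {ω | EvenDistribution state ω} := by
  have : {ω | EvenDistribution state ω} = ⋂ t, {ω | (state t ω).Even} := by
    ext ω; simp [EvenDistribution]
  rw [this]
  exact MeasurableSet.iInter fun t => measurableSet_setOfPred.2 (h.measurable_state Config.Even t)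

lemma measurable_busySteps (h : IsExecution c μ ℱ state victim) (n : ℕ) :
    Measurable fun ω => (busySteps state n ω : ℝ≥0∞) := by
  simp only [busySteps, Finset.card_filter, Nat.cast_sum]
  exact Finset.measurable_sum _ fun u _ => h.measurable_state
    (fun s => ((if s.busy.Nonempty then 1 else 0 : ℕ) : ℝ≥0∞)) u

lemma measurable_accWeight (h : IsExecution c μ ℱ state victim) (i : Option (Fin P)) (n : ℕ) :
    Measurable (accWeight state i n) := by
  unfold accWeight
  exact Finset.measurable_sum _ fun u _ => h.measurable_state (fun s => s.weight i) u

lemma measurable_expWeight (h : IsExecution c μ ℱ state victim) (n : ℕ) :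
    Measurable (expWeight state n) := by
  unfold expWeight
  exact Finset.measurable_sum _ fun i _ =>
    Real.measurable_exp.comp ((h.measurable_accWeight i n).div_const 5)

lemma lintegral_expWeight_le [IsProbabilityMeasure μ] (h : IsExecution c μ ℱ state victim)
    (n : ℕ) : ∫⁻ ω, ENNReal.ofReal (expWeight state n ω) ∂μ
      ≤ ENNReal.ofReal ((P + 1) * (4 ^ (c.Tinf : ℝ) + 1)) := by
  have h1 : ∀ ω, ENNReal.ofReal (expWeight state n ω)
      = ∑ i, ENNReal.ofReal (Real.exp (accWeight state i n ω / 5)) := fun ω =>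
    ENNReal.ofReal_sum_of_nonneg fun _ _ => (Real.exp_pos _).le
  simp_rw [h1]
  have h2 : ∀ i, Measurable fun ω => ENNReal.ofReal (Real.exp (accWeight state i n ω / 5)) :=
    fun i => (Real.measurable_exp.comp
      ((h.measurable_accWeight i n).div_const 5)).ennreal_ofReal
  rw [lintegral_finsetSum _ fun i _ => h2 i]
  refine (Finset.sum_le_sum fun i _ => h.lintegral_exp_accWeight_le i n).trans (le_of_eq ?_)
  rw [ENNReal.ofReal_mul (by positivity), ENNReal.ofReal_add (by positivity) (by positivity),
    ENNReal.ofReal_add (by positivity) (by positivity), Real.rpow_natCast,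
    ENNReal.ofReal_pow (by norm_num)]
  simp [mul_add]

lemma owners_antitone (h : IsExecution c μ ℱ state victim) (ω : Ω) :
    Antitone fun t => (state t ω).owners :=
  antitone_nat_of_succ_le fun t => (h.step t ω).owners_subset

lemma sum_card_busy_le (h : IsExecution c μ ℱ state victim) (n : ℕ) (ω : Ω) :
    ∑ u ∈ Finset.range n, (state u ω).busy.card ≤ c.T1 := by
  suffices (state n ω).work + ∑ u ∈ Finset.range n, (state u ω).busy.card ≤ c.T1 by omega
  induction n with
  | zero => simp [h.init, work_init]
  | succ n ih =>
    have := (h.step n ω).work_add_card_busy_le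
    rw [Finset.sum_range_succ]
    omega

lemma sum_stealsBack_le (h : IsExecution c μ ℱ state victim) (n : ℕ) {ω : Ω}
    (he : EvenDistribution state ω) {Y : ℝ} (hY0 : 0 ≤ Y)
    (hY : ∀ i, accWeight state i n ω ≤ Y) :
    ∑ p, (((Finset.range n).filter fun u => (state u ω).StealsBack p).card : ℝ)
      ≤ P * Y * (1 + Real.log P) := by
  let R : Fin P → Finset ℕ := fun p => (Finset.range n).filter fun u => (state u ω).StealsBack p
  let S : Finset (Fin P) := Finset.univ.filter fun p => (R p).Nonempty
  have hmin : ∀ p, ∃ u, p ∈ S → u ∈ R p ∧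
      ∀ u' ∈ R p, (state u ω).owners.card ≤ (state u' ω).owners.card := by
    intro p
    by_cases hp : p ∈ S
    · obtain ⟨u, hu⟩ := (R p).exists_min_image (fun u => (state u ω).owners.card)
        (Finset.mem_filter.1 hp).2
      exact ⟨u, fun _ => hu⟩
    · exact ⟨0, fun h => absurd h hp⟩
  choose m hm using hmin
  let K : Fin P → ℕ := fun p => (state (m p) ω).owners.card
  have hown : ∀ p ∈ S, p ∈ (state (m p) ω).owners := fun p hp =>
    (Finset.mem_filter.1 (hm p hp).1).2.mem_owners
  have hcount : ∀ r, (S.filter fun p => K p ≤ r).card ≤ r := by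
    intro r
    rcases (S.filter fun p => K p ≤ r).eq_empty_or_nonempty with h0 | h0
    · simp [h0]
    -- At the earliest of the chosen times at most `r` owners are left. All the processors counted
    -- are among them, since they are still owners at their own, later times.
    · obtain ⟨p₀, hp₀, hmin⟩ := (S.filter fun p => K p ≤ r).exists_min_image m h0
      refine le_trans (Finset.card_le_card ?_) (Finset.mem_filter.1 hp₀).2
      intro p hp
      exact h.owners_antitone ω (hmin p hp) (hown p (Finset.mem_filter.1 hp).1)
  have hR : ∀ p ∈ S, ((R p).card : ℝ) ≤ P * Y * (K p : ℝ)⁻¹ := by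
    intro p hp
    have hP : (0 : ℝ) < P := by exact_mod_cast p.pos
    have hK : (0 : ℝ) < K p := by exact_mod_cast Finset.card_pos.2 ⟨p, hown p hp⟩
    have : ((R p).card : ℝ) * (K p / P) ≤ Y := by
      calc ((R p).card : ℝ) * (K p / P) = ∑ u ∈ R p, (K p : ℝ) / P := by simp
        _ ≤ ∑ u ∈ R p, (state u ω).weight (some p) := Finset.sum_le_sum fun u hu => by
            refine le_trans ?_ ((Finset.mem_filter.1 hu).2.weight_ge (he u))
            gcongr
            exact (hm p hp).2 u hu
        _ ≤ accWeight state (some p) n ω := Finset.sum_le_sum_of_subset_of_nonneg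
            (Finset.filter_subset _ _) fun u _ _ => weight_nonneg _ _
        _ ≤ Y := hY _
    rw [← div_eq_mul_inv, le_div_iff₀ hK]
    rw [← mul_div_assoc, div_le_iff₀ hP] at this
    linarith
  have hharm : ∑ p ∈ S, (K p : ℝ)⁻¹ ≤ 1 + Real.log P := by
    have h1 : ∑ p ∈ S, (K p : ℝ)⁻¹ ≤ (harmonic S.card : ℝ) := by
      have := (Rat.cast_le (K := ℝ)).2 (sum_inv_le_harmonic S K hcount)
      rw [Rat.cast_sum] at this
      simpa only [Rat.cast_inv, Rat.cast_natCast] using this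
    refine h1.trans ((harmonic_le_one_add_log _).trans ?_)
    rcases Nat.eq_zero_or_pos S.card with h0 | h0
    · simpa [h0] using Real.log_natCast_nonneg P
    · have : (S.card : ℝ) ≤ P := by
        exact_mod_cast (Finset.card_le_univ S).trans (by simp)
      gcongr
  calc ∑ p, ((R p).card : ℝ) = ∑ p ∈ S, ((R p).card : ℝ) := by
        refine (Finset.sum_subset (Finset.subset_univ S) fun p _ hp => ?_).symm
        have : R p = ∅ := by
          rw [← Finset.not_nonempty_iff_eq_empty]
          exact fun h => hp (Finset.mem_filter.2 ⟨Finset.mem_univ _, h⟩)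
        simp [this]
    _ ≤ ∑ p ∈ S, P * Y * (K p : ℝ)⁻¹ := Finset.sum_le_sum hR
    _ = P * Y * ∑ p ∈ S, (K p : ℝ)⁻¹ := by rw [Finset.mul_sum]
    _ ≤ _ := by gcongr

/-- Busy steps are counted by splitting the `P` processors of each into workers, general thieves and
processors stealing back. The latter two give `P * Y` and `P * Y * (1 + Real.log P)`. -/
lemma busySteps_le (h : IsExecution c μ ℱ state victim) (hP : 1 ≤ P) (n : ℕ) {ω : Ω}
    (he : EvenDistribution state ω) {Y : ℝ} (hY0 : 0 ≤ Y)
    (hY : ∀ i, accWeight state i n ω ≤ Y) :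
    (busySteps state n ω : ℝ) ≤ c.T1 / P + (2 + Real.log P) * Y := by
  have hP' : (0 : ℝ) < P := by exact_mod_cast hP
  let Q := (Finset.range n).filter fun u => (state u ω).busy.Nonempty
  have h1 : (P : ℝ) * busySteps state n ω ≤ c.T1 + P * Y + P * Y * (1 + Real.log P) := by
    calc (P : ℝ) * busySteps state n ω
        = ∑ u ∈ Q, (((state u ω).busy.card : ℝ) + (state u ω).free.card) := by
          have : ∀ u, ((state u ω).busy.card : ℝ) + (state u ω).free.card = P := fun u => by
            exact_mod_cast (state u ω).card_busy_add_card_free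
          simp [this, busySteps, Q, mul_comm]
      _ = ∑ u ∈ Q, (((state u ω).busy.card : ℝ) + P * (state u ω).weight none
            + ∑ p, if (state u ω).StealsBack p then 1 else 0) := by
          refine Finset.sum_congr rfl fun u hu => ?_
          rw [card_free_eq _ (Finset.mem_filter.1 hu).2, add_assoc]
      _ ≤ ∑ u ∈ Finset.range n, (((state u ω).busy.card : ℝ) + P * (state u ω).weight none
            + ∑ p, if (state u ω).StealsBack p then 1 else 0) := by
          refine Finset.sum_le_sum_of_subset_of_nonneg (Finset.filter_subset _ _) fun u _ _ => ?_
          have := (state u ω).weight_nonneg none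
          positivity
      _ = ((∑ u ∈ Finset.range n, (state u ω).busy.card : ℕ) : ℝ) + P * accWeight state none n ω
            + ∑ p, (((Finset.range n).filter fun u => (state u ω).StealsBack p).card : ℝ) := by
          rw [Finset.sum_add_distrib, Finset.sum_add_distrib, accWeight, Finset.mul_sum,
            Finset.sum_comm (s := Finset.range n) (t := Finset.univ)]
          simp
      _ ≤ _ := by
          gcongr
          · exact h.sum_card_busy_le n ω
          · exact hY none
          · exact h.sum_stealsBack_le n he hY0 hY
  rw [div_add' _ _ _ hP'.ne', le_div_iff₀ hP']
  linarith

lemma busySteps_le_log_expWeight (h : IsExecution c μ ℱ state victim) (hP : 1 ≤ P) (n : ℕ)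
    {ω : Ω} (he : EvenDistribution state ω) :
    (busySteps state n ω : ℝ)
      ≤ c.T1 / P + 15 * Real.logb 2 P * Real.log (expWeight state n ω) := by
  rcases hP.eq_or_lt with rfl | hP2
  -- A single processor never steals, so `Y = 0` works; this matches `lg P = 0`.
  · have := h.busySteps_le hP n he le_rfl fun i => by
      simp [accWeight, weight_eq_zero_of_one]
    simpa using this
  · have hP' : (2 : ℝ) ≤ P := by exact_mod_cast hP2
    have hnn : 0 ≤ Real.log (expWeight state n ω) := by
      have h1 := accWeight_le_log_expWeight state none n ω
      have h2 := accWeight_nonneg state none n ω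
      linarith
    refine (h.busySteps_le hP n he (by positivity)
      fun i => accWeight_le_log_expWeight state i n ω).trans ?_
    have h1 := log_le_logb_two (x := P) (by linarith)
    have h2 : 1 ≤ Real.logb 2 P := by
      rw [Real.le_logb_iff_rpow_le (by norm_num) (by linarith)]
      simpa using hP'
    have h3 : (2 + Real.log P) ≤ 3 * Real.logb 2 P := by linarith
    have := mul_le_mul_of_nonneg_right h3 hnn
    linarith

lemma one_le_Tinf (hP : 2 ≤ P) : (1 : ℝ) ≤ c.Tinf := by
  have hP' : (2 : ℝ) ≤ P := by exact_mod_cast hP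
  refine le_trans ?_ (logb_le_Tinf c (by omega))
  rw [Real.le_logb_iff_rpow_le (by norm_num) (by linarith)]
  simpa using hP'

lemma setLIntegral_busySteps_le [IsProbabilityMeasure μ] (h : IsExecution c μ ℱ state victim)
    (hP : 1 ≤ P) (n : ℕ) :
    ∫⁻ ω in {ω | EvenDistribution state ω}, (busySteps state n ω : ℝ≥0∞) ∂μ
      ≤ ENNReal.ofReal ((c.T1 : ℝ) / P) * μ {ω | EvenDistribution state ω}
        + ENNReal.ofReal (90 * (c.Tinf * Real.logb 2 P)) := by
  set E := {ω | EvenDistribution state ω}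
  set L := Real.logb 2 P with hL
  have hP' : (1 : ℝ) ≤ P := by exact_mod_cast hP
  have hL0 : 0 ≤ L := Real.logb_nonneg (by norm_num) hP'
  set B : ℝ := (P + 1) * (4 ^ (c.Tinf : ℝ) + 1) with hB
  have hB0 : 0 < B := by positivity
  have hpt : ∀ ω ∈ E, (busySteps state n ω : ℝ≥0∞) ≤ ENNReal.ofReal ((c.T1 : ℝ) / P)
      + (ENNReal.ofReal (75 * (c.Tinf * L))
        + ENNReal.ofReal (15 * L / B) * ENNReal.ofReal (expWeight state n ω)) := by
    intro ω hω
    have h0 := expWeight_pos state n ω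
    rw [← ENNReal.ofReal_mul (by positivity), ← ENNReal.ofReal_add (by positivity) (by positivity),
      ← ENNReal.ofReal_add (by positivity) (by positivity), ← ENNReal.ofReal_natCast]
    refine ENNReal.ofReal_le_ofReal ((h.busySteps_le_log_expWeight hP n hω).trans ?_)
    gcongr
    rcases hP.eq_or_lt with rfl | hP2
    · simp [hL]
    -- The tangent of the logarithm at `B`, the bound on the expectation of `expWeight`, replaces
    -- Jensen's inequality. It stays usable when integrating over the even distribution event only.
    · have hlog : Real.log (expWeight state n ω) ≤ Real.log B + expWeight state n ω / B := by
        have := Real.log_le_sub_one_of_pos (div_pos h0 hB0)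
        rw [Real.log_div h0.ne' hB0.ne'] at this
        linarith
      have hlogB : Real.log B ≤ 5 * c.Tinf := by
        have h1 := log_bound (P := P) (by exact_mod_cast hP2) (one_le_Tinf (c := c) hP2)
          zero_lt_one
        rw [div_one, div_one] at h1
        have h2 := log_le_logb_two hP'
        have h3 := logb_le_Tinf c hP
        linarith
      calc 15 * L * Real.log (expWeight state n ω)
          ≤ 15 * L * (5 * c.Tinf + expWeight state n ω / B) := by gcongr; linarith
        _ = _ := by ring
  calc ∫⁻ ω in E, (busySteps state n ω : ℝ≥0∞) ∂μ
      ≤ ∫⁻ ω in E, (ENNReal.ofReal ((c.T1 : ℝ) / P) + (ENNReal.ofReal (75 * (c.Tinf * L))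
        + ENNReal.ofReal (15 * L / B) * ENNReal.ofReal (expWeight state n ω))) ∂μ :=
        setLIntegral_mono' h.measurableSet_evenDistribution hpt
    _ = ENNReal.ofReal ((c.T1 : ℝ) / P) * μ E + (ENNReal.ofReal (75 * (c.Tinf * L)) * μ E
        + ENNReal.ofReal (15 * L / B) * ∫⁻ ω in E, ENNReal.ofReal (expWeight state n ω) ∂μ) := by
        rw [lintegral_add_left measurable_const, lintegral_add_left measurable_const,
          lintegral_const_mul' _ _ (by simp), setLIntegral_const, setLIntegral_const]
    _ ≤ ENNReal.ofReal ((c.T1 : ℝ) / P) * μ E + (ENNReal.ofReal (75 * (c.Tinf * L)) * 1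
        + ENNReal.ofReal (15 * L / B) * ENNReal.ofReal B) := by
        gcongr
        · exact prob_le_one
        · exact (setLIntegral_le_lintegral _ _).trans (h.lintegral_expWeight_le n)
    _ = ENNReal.ofReal ((c.T1 : ℝ) / P) * μ E + ENNReal.ofReal (75 * (c.Tinf * L) + 15 * L) := by
        rw [mul_one, ← ENNReal.ofReal_mul (by positivity), div_mul_cancel₀ _ hB0.ne',
          ← ENNReal.ofReal_add (by positivity) (by positivity)]
    -- Here `15 * L` is absorbed by `1 ≤ Tinf`, so that `75 + 15 = 90`.
    _ ≤ _ := by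
        gcongr
        rcases hP.eq_or_lt with rfl | hP2
        · simp [hL]
        · have := mul_le_mul_of_nonneg_right (one_le_Tinf (c := c) hP2) hL0
          linarith

lemma setLIntegral_runningTime_le [IsProbabilityMeasure μ] (h : IsExecution c μ ℱ state victim)
    (hP : 1 ≤ P) :
    ∫⁻ ω in {ω | EvenDistribution state ω}, runningTime state ω ∂μ
      ≤ ENNReal.ofReal ((c.T1 : ℝ) / P) * μ {ω | EvenDistribution state ω}
        + ENNReal.ofReal (90 * (c.Tinf * Real.logb 2 P)) := by
  calc _ ≤ ∫⁻ ω in {ω | EvenDistribution state ω}, ⨆ n, (busySteps state n ω : ℝ≥0∞) ∂μ :=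
        lintegral_mono fun ω => runningTime_le_iSup_busySteps state ω
    _ = ⨆ n, ∫⁻ ω in {ω | EvenDistribution state ω}, (busySteps state n ω : ℝ≥0∞) ∂μ :=
        lintegral_iSup h.measurable_busySteps fun n m hnm ω => by
          exact_mod_cast busySteps_mono state ω hnm
    _ ≤ _ := iSup_le fun n => h.setLIntegral_busySteps_le hP n

/-- Markov's inequality for `expWeight` at the level `B / ε`. Exceeding the time bound forces `log
(expWeight)` above `6 * (Tinf + lg (P / ε))`, where `90 = 15 * 6`, and this exceeds `log (B / ε)`.
-/
lemma measure_busySteps_gt_le [IsProbabilityMeasure μ] (h : IsExecution c μ ℱ state victim)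
    (hP : 1 ≤ P) (n : ℕ) {ε : ℝ} (hε : 0 < ε) (hε1 : ε < 1) :
    μ {ω | EvenDistribution state ω ∧
        ENNReal.ofReal ((c.T1 : ℝ) / P
          + 90 * (Real.logb 2 P * (c.Tinf + Real.logb 2 (P / ε)))) < busySteps state n ω}
      ≤ ENNReal.ofReal ε := by
  set B : ℝ := (P + 1) * (4 ^ (c.Tinf : ℝ) + 1) with hB
  have hB0 : 0 < B := by positivity
  have hP' : (1 : ℝ) ≤ P := by exact_mod_cast hP
  have hPε : 1 ≤ P / ε := (one_le_div₀ hε).2 (by linarith)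
  have hsub : {ω | EvenDistribution state ω ∧
        ENNReal.ofReal ((c.T1 : ℝ) / P
          + 90 * (Real.logb 2 P * (c.Tinf + Real.logb 2 (P / ε)))) < busySteps state n ω}
      ⊆ {ω | ENNReal.ofReal (B / ε) ≤ ENNReal.ofReal (expWeight state n ω)} := by
    rintro ω ⟨he, hlt⟩
    have hL0 : 0 ≤ Real.logb 2 P := Real.logb_nonneg (by norm_num) hP'
    have hX0 : 0 ≤ Real.logb 2 (P / ε) := Real.logb_nonneg (by norm_num) hPε
    rw [← ENNReal.ofReal_natCast, ENNReal.ofReal_lt_ofReal_iff'] at hlt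
    have hlt' := hlt.1.trans_le (h.busySteps_le_log_expWeight hP n he)
    rcases hP.eq_or_lt with rfl | hP2
    · simp at hlt'
    · have hL : 0 < Real.logb 2 P := Real.logb_pos (by norm_num) (by exact_mod_cast hP2)
      have h1 : 6 * (c.Tinf + Real.logb 2 (P / ε)) < Real.log (expWeight state n ω) := by
        by_contra! hcon
        have := mul_le_mul_of_nonneg_left hcon hL.le
        linarith
      have h2 := log_bound (P := P) (by exact_mod_cast hP2) (one_le_Tinf (c := c) hP2) hε
      have h3 := log_le_logb_two hPε
      have hT := one_le_Tinf (c := c) hP2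
      refine ENNReal.ofReal_le_ofReal ?_
      rw [← Real.log_le_log_iff (by positivity) (expWeight_pos state n ω)]
      linarith
  refine (measure_mono hsub).trans ((meas_ge_le_lintegral_div
    (h.measurable_expWeight n).ennreal_ofReal.aemeasurable (by simp; positivity)
    (by simp)).trans ?_)
  rw [ENNReal.div_le_iff (by simp; positivity) (by simp), ← ENNReal.ofReal_mul hε.le,
    mul_div_cancel₀ _ hε.ne']
  exact h.lintegral_expWeight_le n

lemma measure_runningTime_gt_le [IsProbabilityMeasure μ] (h : IsExecution c μ ℱ state victim)
    (hP : 1 ≤ P) {ε : ℝ} (hε : 0 < ε) :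
    μ {ω | EvenDistribution state ω ∧
        ENNReal.ofReal ((c.T1 : ℝ) / P
          + 90 * (Real.logb 2 P * (c.Tinf + Real.logb 2 (P / ε)))) < runningTime state ω}
      ≤ ENNReal.ofReal ε := by
  rcases le_or_gt 1 ε with hε1 | hε1
  · exact prob_le_one.trans (by simpa using hε1)
  · set a := ENNReal.ofReal ((c.T1 : ℝ) / P
      + 90 * (Real.logb 2 P * (c.Tinf + Real.logb 2 (P / ε))))
    have hsub : {ω | EvenDistribution state ω ∧ a < runningTime state ω}
        ⊆ ⋃ n, {ω | EvenDistribution state ω ∧ a < busySteps state n ω} := by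
      rintro ω ⟨he, hω⟩
      obtain ⟨n, hn⟩ := lt_iSup_iff.1 (hω.trans_le (runningTime_le_iSup_busySteps state ω))
      exact Set.mem_iUnion.2 ⟨n, he, hn⟩
    -- The events increase with `n`, so continuity from below gives the union the same bound `ε`.
    have hmono : Monotone fun n => {ω | EvenDistribution state ω ∧ a < busySteps state n ω} :=
      fun n m hnm ω hω => ⟨hω.1, hω.2.trans_le (by exact_mod_cast busySteps_mono state ω hnm)⟩
    refine (measure_mono hsub).trans ?_
    rw [hmono.measure_iUnion]
    exact iSup_le fun n => h.measure_busySteps_gt_le hP n hε hε1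

end IsExecution

/-- The first two claims hold for every execution, restricted to the event that the even
distribution of free agents assumption holds; the last two are the case that it holds surely. -/
theorem theorem2 :
    ∃ C : ℝ, 0 < C ∧
      ∀ (P : ℕ), 1 ≤ P → ∀ (c : TaskComputation P)
        (Ω : Type*) [mΩ : MeasurableSpace Ω] (μ : Measure Ω) [IsProbabilityMeasure μ]
        (ℱ : Filtration ℕ mΩ) (state : ℕ → Ω → Config P) (victim : ℕ → Ω → Fin P → Fin P),
        IsExecution c μ ℱ state victim →
        (∫⁻ ω in {ω | EvenDistribution state ω}, runningTime state ω ∂μ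
            ≤ ENNReal.ofReal ((c.T1 : ℝ) / P) * μ {ω | EvenDistribution state ω}
              + ENNReal.ofReal (C * (c.Tinf * Real.logb 2 P))) ∧
        (∀ ε : ℝ, 0 < ε →
          μ {ω | EvenDistribution state ω ∧
              ENNReal.ofReal ((c.T1 : ℝ) / P
                + C * (Real.logb 2 P * (c.Tinf + Real.logb 2 (P / ε)))) < runningTime state ω}
            ≤ ENNReal.ofReal ε) ∧
        ((∀ᵐ ω ∂μ, EvenDistribution state ω) →
          (∫⁻ ω, runningTime state ω ∂μ
            ≤ ENNReal.ofReal ((c.T1 : ℝ) / P + C * (c.Tinf * Real.logb 2 P))) ∧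
          (∀ ε : ℝ, 0 < ε →
            ENNReal.ofReal (1 - ε) ≤
              μ {ω | runningTime state ω ≤
                ENNReal.ofReal ((c.T1 : ℝ) / P
                  + C * (Real.logb 2 P * (c.Tinf + Real.logb 2 (P / ε))))})) := by

  refine ⟨90, by norm_num, fun P hP c Ω mΩ μ _ ℱ state victim h =>
    ⟨h.setLIntegral_runningTime_le hP, fun ε hε => h.measure_runningTime_gt_le hP hε,
      fun hE => ⟨?_, fun ε hε => ?_⟩⟩⟩
  · have h1 := h.setLIntegral_runningTime_le hP
    have hμ : μ {ω | EvenDistribution state ω} = 1 := (mem_ae_iff_prob_eq_one h.measurableSet_evenDistribution).1 hE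
    have hP' : (1 : ℝ) ≤ P := by exact_mod_cast hP
    have hL0 : 0 ≤ Real.logb 2 P := Real.logb_nonneg (by norm_num) hP'
    have hr : μ.restrict {ω | EvenDistribution state ω} = μ :=
      Measure.restrict_eq_self_of_ae_mem hE
    rwa [hr, hμ, mul_one,
      ← ENNReal.ofReal_add (by positivity) (by positivity)] at h1
  · have h1 := h.measure_runningTime_gt_le hP hε
    set a := ENNReal.ofReal ((c.T1 : ℝ) / P
      + 90 * (Real.logb 2 P * (c.Tinf + Real.logb 2 (P / ε))))
    have h2 : (1 : ℝ≥0∞) ≤ ENNReal.ofReal ε + μ {ω | runningTime state ω ≤ a} := by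
      calc (1 : ℝ≥0∞) = μ {ω | EvenDistribution state ω} := ((mem_ae_iff_prob_eq_one h.measurableSet_evenDistribution).1 hE).symm
        _ ≤ μ ({ω | EvenDistribution state ω ∧ a < runningTime state ω}
              ∪ {ω | runningTime state ω ≤ a}) := measure_mono fun ω hω =>
            (lt_or_ge a (runningTime state ω)).imp (fun h => ⟨hω, h⟩) id
        _ ≤ _ := (measure_union_le _ _).trans (by gcongr)
    rw [ENNReal.ofReal_sub _ hε.le, ENNReal.ofReal_one]
    exact tsub_le_iff_left.2 h2
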